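/- All graphs are finite and simple. A cover of a graph $G$ is a pair $\mathcal H=(L,\Gamma)$, where $\Gamma$ is a graph and $L$ assigns to each $u\in V(G)$ a subset $L(u)$ of $V(\Gamma)$, such that (1) the sets $L(u)$, $u \in V(G)$, partition $V(\Gamma)$; (2) each $L(u)$ is a clique of $\Gamma$; (3) if $\Gamma$ has an edge between $L(u)$ and $L(v)$, then $u=v$ or $uv\in E(G)$; (4) if $uv\in E(G)$, then the edges of $\Gamma$ between $L(u)$ and $L(v)$ form a (possibly empty) matching. The cover is $m$-fold if $|L(u)|=m$ for every $u\in V(G)$. An $\mathcal H$-coloring of $G$ is an independent set of $\Gamma$ of size $|V(G)|$. Let $P(G,m)$ be the number of proper $m$-colorings of $G$, and let $P_{DP}(G,m)$ be the minimum, over all $m$-fold covers $\mathcal H$ of $G$, of the number of $\mathcal H$-colorings of $G$. If the common vertices of two graphs $H$ and $M$ form a nonempty clique in both of them, their clique-sum $H\oplus M$ is the graph with vertex set $V(H)\cup V(M)$ and edge set $E(H)\cup E(M)$. Let $C_n$ denote the cycle on $n$ vertices. Suppose that $H$ and $M$ are cycles that share exactly one edge, and that $G=H\oplus M$ is their clique-sum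 (so $H$ and $M$ have exactly the two ends of that edge in common). Then: (i) If $H=C_{2k+1}$ and $M=C_{2l+1}$ with $l\ge k\ge 1$, then $P_{DP}(G,m)=P(G,m)$ for every integer $m\ge 1$. (ii) If $H=C_{2k+2}$ and $M=C_{2l+2}$ with $l\ge k\ge 1$, then for every integer $m\ge 3$ $$P_{DP}(G,m)=\frac1m\left[(m-1)^{2k+2l+3}-(m-1)^{2l+1}-(m-1)^{2k+1}-m-1\right].$$ (iii) If $H=C_{2k+1}$ and $M=C_{2l+2}$ with $k,l\ge 1$, then for every integer $m\ge 2$ $$P_{DP}(G,m)=\frac1m\left[(m-1)^{2k+2l+2}-(m-1)^{2k}-(m-1)^{2l+2}+1\right].$$ -/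

import Mathlib

universe u

namespace SimpleGraph

/-- A cover `(L, H)` of a graph `G`, where `H` is a graph with vertex set `W`. -/
structure DPCover {V : Type*} (G : SimpleGraph V) (W : Type*) where
  /-- The graph `H`. -/
  graph : SimpleGraph W
  /-- The vertices of `H` that stand for the colors available at a vertex of `G`. -/
  L : V → Finset W
  /-- The sets `L u` partition the vertex set of `H`. -/
  partition : ∀ w : W, ∃! u : V, w ∈ L u
  /-- Each `L u` induces a complete subgraph of `H`. -/
  isClique : ∀ u : V, graph.IsClique (L u : Set W)
  /-- If there is an edge of `H` between `L u` and `L v`, then `u = v` or `uv` is an edge of `G`. -/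
  eq_or_adj : ∀ u v : V, ∀ x ∈ L u, ∀ y ∈ L v, graph.Adj x y → u = v ∨ G.Adj u v
  /-- If `uv` is an edge of `G`, the edges of `H` between `L u` and `L v` form a matching: no
  `x ∈ L u` lies on two of them, and (exchanging `u` and `v`) neither does any element of `L v`. -/
  matching : ∀ u v : V, G.Adj u v → ∀ x ∈ L u, ∀ y ∈ L v, ∀ z ∈ L v,
    graph.Adj x y → graph.Adj x z → y = z

/-- A cover is `m`-fold if every `L u` has exactly `m` elements. -/
def DPCover.IsFold {V W : Type*} {G : SimpleGraph V} (C : G.DPCover W) (m : ℕ) : Prop :=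
  ∀ u : V, (C.L u).card = m

/-- The number of colorings of `G` from a cover `(L, H)`, that is, of independent sets of `H` of
size `|V(G)|`. -/
noncomputable def DPCover.numColorings {V W : Type*} [Fintype V] {G : SimpleGraph V}
    (C : G.DPCover W) : ℕ :=
  {I : Finset W | C.graph.IsNIndepSet (Fintype.card V) I}.ncard

/-- The set of the values of `numColorings` over all `m`-fold covers of `G` by finite graphs. -/
def dpColoringCounts {V : Type u} [Fintype V] (G : SimpleGraph V) (m : ℕ) : Set ℕ :=
  {n | ∃ (W : Type u) (_ : Fintype W) (C : G.DPCover W), C.IsFold m ∧ C.numColorings = n}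

/-- The DP color function of `G`: the least number of colorings over all `m`-fold covers. -/
noncomputable def dpColorFunction {V : Type u} [Fintype V] (G : SimpleGraph V) (m : ℕ) : ℕ :=
  sInf (G.dpColoringCounts m)

/-- The number `P(G, m)` of proper `m`-colorings of `G`. -/
noncomputable def numProperColorings {V : Type*} (G : SimpleGraph V) (m : ℕ) : ℕ :=
  Nat.card (G.Coloring (Fin m))

/-- `G` is the clique-sum of its subgraphs `H` and `M`: it is their union, and their common
vertices form a nonempty clique in both of them. -/
def IsCliqueSum {V : Type*} (G : SimpleGraph V) (H M : G.Subgraph) : Prop :=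
  H ⊔ M = ⊤ ∧ (H.verts ∩ M.verts).Nonempty ∧
    (H.verts ∩ M.verts).Pairwise H.Adj ∧ (H.verts ∩ M.verts).Pairwise M.Adj

/-- The subgraph `H` is a cycle `C_n` (for `n ≥ 3`). -/
def Subgraph.IsCycleOfLength {V : Type*} {G : SimpleGraph V} (H : G.Subgraph) (n : ℕ) : Prop :=
  Nonempty (H.coe ≃g cycleGraph n)

/-- Every graph has an `m`-fold cover, so the minimum in `dpColorFunction` is attained. -/
theorem dpColoringCounts_nonempty {V : Type u} [Fintype V] (G : SimpleGraph V) (m : ℕ) :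
    (G.dpColoringCounts m).Nonempty := by
  classical
  refine ⟨_, V × Fin m, inferInstance,
    { graph := SimpleGraph.fromRel (fun x y => x.1 = y.1)
      L := fun u => Finset.univ.filter (fun x => x.1 = u)
      partition := fun w => ⟨w.1, by simp, by simp⟩
      isClique := fun u x hx y hy hxy => by
        simp only [Finset.coe_filter, Finset.mem_univ, true_and, Set.mem_ofPred_eq] at hx hy
        simp [hx, hy, hxy]
      eq_or_adj := fun u v x hx y hy h => by
        simp only [Finset.mem_filter, Finset.mem_univ, true_and] at hx hy
        simp only [SimpleGraph.fromRel_adj] at h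
        left; rcases h with ⟨_, h | h⟩
        · rw [← hx, ← hy, h]
        · rw [← hx, ← hy, h]
      matching := fun u v huv x hx y hy z hz h _ => by
        simp only [Finset.mem_filter, Finset.mem_univ, true_and] at hx hy
        simp only [SimpleGraph.fromRel_adj] at h
        have : u = v := by
          rcases h with ⟨_, h | h⟩
          · rw [← hx, ← hy, h]
          · rw [← hx, ← hy, h]
        exact absurd this huv.ne }, fun u => ?_, rfl⟩
  change (Finset.univ.filter (fun x : V × Fin m => x.1 = u)).card = m
  have h : (Finset.univ.filter (fun x : V × Fin m => x.1 = u)) = {u} ×ˢ Finset.univ := by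
    ext ⟨a, b⟩
    simp [eq_comm]
  rw [h]
  simp

/-- `dpColorFunction` is the minimum over all `m`-fold covers. -/
theorem isLeast_dpColorFunction {V : Type u} [Fintype V] (G : SimpleGraph V) (m : ℕ) :
    IsLeast (G.dpColoringCounts m) (G.dpColorFunction m) :=
  ⟨Nat.sInf_mem (G.dpColoringCounts_nonempty m), fun _ h => Nat.sInf_le h⟩

end SimpleGraph

/-!
In an `m`-fold cover, adding edges only destroys colorings, so the minimum is attained when every
matching is perfect. After the lists are identified with `Fin m`, such a cover is a family of
permutations `g u v = (g v u)⁻¹`, and its colorings are the maps `c : V → Fin m` with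
`c v ≠ g u v (c u)` on every edge (`exists_dpColorFunction_eq`).

The number of such maps on a path with `n` edges with prescribed end colors `i` and `j` depends only
on whether the product `Φ` of the permutations along the path sends `i` to `j`: it is
`y n + (-1) ^ n * [Φ i = j]`, where `m * y n = (m - 1) ^ n - (-1) ^ n` (`numTwistedPaths_eq`).

The clique-sum `G` consists of an edge `ab` and two paths from `a` to `b`, with `p` and `q` edges.
Summing over the pairs of colors allowed on `ab`, whose permutation is `ψ`, the number of twisted
colorings is, with `Φ` and `Θ` the products along the two paths,
`m (m - 1) y_p y_q + (-1) ^ p y_q #{Φ i ≠ ψ i} + (-1) ^ q y_p #{Θ i ≠ ψ i}`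
`+ (-1) ^ (p + q) #{Φ i = Θ i ≠ ψ i}` (`IsThetaGraph.numTwistedColorings_eq`).

It remains to minimize over `Φ`, `Θ`, `ψ`, where any `Φ` and `Θ` are possible with `ψ = 1`
(`IsThetaGraph.exists_twist`). For `p` and `q` even all terms are nonnegative, and the trivial twist,
which counts proper colorings, is optimal. For `p` and `q` odd the optimum is that `Φ` and `Θ` are
derangements that agree nowhere, such as the translations by `1` and by `2` when `m ≥ 3`. For `p`
even and `q` odd the optimum is that `Φ` is trivial and `Θ` is a derangement.
-/

namespace SimpleGraph

open Finset

/-! ### Colorings twisted by permutations -/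

/-- An independent set of size `|V|` meets every clique `L v` in exactly one vertex, so it is the
same thing as a choice of pairwise non-adjacent colors from the sets `L v`. -/
theorem DPCover.numColorings_eq_card {V W : Type*} [Fintype V] {G : SimpleGraph V}
    (C : G.DPCover W) :
    C.numColorings =
      Nat.card {c : V → W // (∀ v, c v ∈ C.L v) ∧ ∀ u v, ¬ C.graph.Adj (c u) (c v)} := by
  classical
  have inj : ∀ c : V → W, (∀ v, c v ∈ C.L v) → Function.Injective c := fun c hc u v huv =>
    (C.partition (c u)).unique (hc u) (huv ▸ hc v)
  symm
  rw [DPCover.numColorings, ← Nat.card_coe_set_eq]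
  refine Nat.card_eq_of_bijective (fun c => ⟨univ.image c.1, ?_, ?_⟩) ⟨?_, ?_⟩
  · intro x hx y hy _
    obtain ⟨u, -, rfl⟩ := mem_image.1 hx
    obtain ⟨v, -, rfl⟩ := mem_image.1 hy
    exact c.2.2 u v
  · rw [card_image_of_injective _ (inj c.1 c.2.1), card_univ]
  · rintro ⟨c, hc, _⟩ ⟨d, hd, _⟩ h
    have h : univ.image c = univ.image d := congrArg Subtype.val h
    ext v
    obtain ⟨u, -, hu⟩ := mem_image.1 (h ▸ mem_image_of_mem c (mem_univ v))
    have : u = v := (C.partition (d u)).unique (hd u) (hu ▸ hc v)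
    exact this ▸ hu.symm
  · rintro ⟨I, hI, hcard⟩
    choose f hf hf' using C.partition
    -- `f` sends a vertex of the cover to the vertex of `G` whose list contains it.
    have hinj : Set.InjOn f I := by
      intro x hx y hy hxy
      by_contra hne
      exact hI hx hy hne (C.isClique (f x) (hf x) (hxy ▸ hf y) hne)
    have himg : I.image f = univ := by
      rw [← card_eq_iff_eq_univ, card_image_of_injOn hinj, hcard]
    have hex : ∀ v, ∃ x ∈ I, f x = v := fun v => mem_image.1 (himg ▸ mem_univ v)
    choose c hcI hcf using hex
    refine ⟨⟨c, fun v => ?_, fun u v huv => ?_⟩, ?_⟩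
    · have := hf (c v)
      rwa [hcf] at this
    · exact hI (hcI u) (hcI v) huv.ne huv
    · apply Subtype.ext
      ext x
      simp only [mem_image, mem_univ, true_and]
      constructor
      · rintro ⟨v, rfl⟩
        exact hcI v
      · exact fun hx => ⟨f x, hinj (hcI _) hx (hcf _)⟩

open Classical in
/-- The number of maps `c : V → Fin m` such that `c v ≠ g u v (c u)` for every ordered pair of
adjacent vertices. For `g v u = (g u v)⁻¹` the two conditions on an edge agree, and these are the
colorings from the `m`-fold cover whose matchings are the graphs of the permutations `g u v`. -/
noncomputable def numTwistedColorings {V : Type*} [Fintype V] (G : SimpleGraph V) {m : ℕ}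
    (g : V → V → Equiv.Perm (Fin m)) : ℕ :=
  #{c : V → Fin m | ∀ u v, G.Adj u v → c v ≠ g u v (c u)}

theorem numTwistedColorings_one {V : Type*} [Fintype V] (G : SimpleGraph V) (m : ℕ) :
    G.numTwistedColorings (fun _ _ => (1 : Equiv.Perm (Fin m))) = G.numProperColorings m := by
  classical
  rw [numTwistedColorings, numProperColorings, ← Fintype.card_subtype, ← Nat.card_eq_fintype_card]
  exact Nat.card_congr
    { toFun := fun c => Coloring.mk c.1 fun {u v} h => (c.2 u v h).symm
      invFun := fun c => ⟨c, fun u v h => (c.valid h).symm⟩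
      left_inv := fun _ => rfl
      right_inv := fun _ => rfl }

theorem numTwistedColorings_mem_dpColoringCounts {V : Type u} [Fintype V] (G : SimpleGraph V)
    {m : ℕ} (g : V → V → Equiv.Perm (Fin m)) (hg : ∀ u v, g v u = (g u v)⁻¹) :
    G.numTwistedColorings g ∈ G.dpColoringCounts m := by
  classical
  have hg' : ∀ u v x y, g u v x = y ↔ g v u y = x := fun u v x y => by
    rw [hg u v, Equiv.Perm.inv_eq_iff_eq, eq_comm]
  let C : G.DPCover (V × Fin m) :=
    { graph :=
        { Adj := fun x y => (x.1 = y.1 ∧ x.2 ≠ y.2) ∨ (G.Adj x.1 y.1 ∧ g x.1 y.1 x.2 = y.2)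
          symm := ⟨fun x y h => h.imp (fun h => ⟨h.1.symm, h.2.symm⟩)
            (fun h => ⟨h.1.symm, (hg' _ _ _ _).1 h.2⟩)⟩
          loopless := ⟨fun x h => h.elim (fun h => h.2 rfl) (fun h => h.1.ne rfl)⟩ }
      L := fun u => univ.filter fun x => x.1 = u
      partition := fun w => ⟨w.1, by simp, by simp⟩
      isClique := fun u x hx y hy hxy => by
        simp only [coe_filter, mem_univ, true_and, Set.mem_ofPred_eq] at hx hy
        exact Or.inl ⟨hx.trans hy.symm, fun h => hxy (Prod.ext (hx.trans hy.symm) h)⟩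
      eq_or_adj := fun u v x hx y hy h => by
        simp only [mem_filter, mem_univ, true_and] at hx hy
        subst hx hy
        exact h.imp (fun h => h.1) (fun h => h.1)
      matching := fun u v huv x hx y hy z hz h h' => by
        simp only [mem_filter, mem_univ, true_and] at hx hy hz
        subst hx hy
        have h2 := (h.resolve_left fun h => huv.ne h.1).2
        have h2' := (h'.resolve_left fun h => huv.ne (h.1.trans hz)).2
        rw [hz] at h2'
        exact Prod.ext hz.symm (h2.symm.trans h2') }
  have hL : ∀ u x, x ∈ C.L u ↔ x.1 = u := fun u x => by simp [C]
  refine ⟨V × Fin m, inferInstance, C, fun u => ?_, ?_⟩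
  · have : C.L u = {u} ×ˢ univ := by
      ext ⟨a, b⟩
      simp [hL, eq_comm]
    simp [this]
  · rw [C.numColorings_eq_card, numTwistedColorings, ← Fintype.card_subtype,
      ← Nat.card_eq_fintype_card]
    refine Nat.card_congr
      { toFun := fun c => ⟨fun v => (c.1 v).2, fun u v huv h => c.2.2 u v ?_⟩
        invFun := fun c => ⟨fun v => (v, c.1 v), fun v => (hL _ _).2 rfl, fun u v h => ?_⟩
        left_inv := fun c => ?_
        right_inv := fun _ => rfl }
    · have h1 := fun v => (hL _ _).1 (c.2.1 v)
      exact Or.inr ⟨by rwa [h1, h1], by rw [h1, h1]; exact h.symm⟩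
    · rcases h with h | h
      · have h1 : u = v := h.1
        exact h.2 (congrArg c.1 h1)
      · exact c.2 u v h.1 h.2.symm
    · exact Subtype.ext (funext fun v => Prod.ext ((hL _ _).1 (c.2.1 v)).symm rfl)

/-- The matching between two lists, read in coordinates on them, extends to a permutation. -/
theorem DPCover.exists_perm_extending_matching {V W : Type*} {G : SimpleGraph V} (C : G.DPCover W)
    {m : ℕ} (e : ∀ v, C.L v ≃ Fin m) {u v : V} (huv : G.Adj u v) :
    ∃ σ : Equiv.Perm (Fin m), ∀ i j,
      C.graph.Adj ((e u).symm i : W) ((e v).symm j) → σ i = j := by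
  classical
  let s : Finset (Fin m) :=
    univ.filter fun i => ∃ j, C.graph.Adj ((e u).symm i : W) ((e v).symm j)
  let f : Fin m → Fin m := fun i =>
    if h : ∃ j, C.graph.Adj ((e u).symm i : W) ((e v).symm j) then h.choose else i
  have hf : ∀ i j, C.graph.Adj ((e u).symm i : W) ((e v).symm j) → f i = j := by
    intro i j h
    have hex : ∃ j, C.graph.Adj ((e u).symm i : W) ((e v).symm j) := ⟨j, h⟩
    have := C.matching u v huv _ ((e u).symm i).2 _ ((e v).symm hex.choose).2 _
      ((e v).symm j).2 hex.choose_spec h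
    simp only [f, dif_pos hex]
    exact (e v).symm.injective (Subtype.ext this)
  have hinj : Set.InjOn f s := by
    intro i hi i' hi' hii
    obtain ⟨j, hj⟩ := (mem_filter.1 hi).2
    obtain ⟨j', hj'⟩ := (mem_filter.1 hi').2
    have : j = j' := (hf i j hj).symm.trans (hii.trans (hf i' j' hj'))
    subst this
    exact (e u).symm.injective (Subtype.ext (C.matching v u huv.symm _ ((e v).symm j).2 _
      ((e u).symm i).2 _ ((e u).symm i').2 hj.symm hj'.symm))
  obtain ⟨σ, hσ⟩ := exists_equiv_extend_of_card_eq (α := Fin m) (t := (univ : Finset (Fin m)))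
    (by simp) (s := s) (f := f) (subset_univ _) hinj
  refine ⟨σ.trans (Equiv.subtypeUnivEquiv (by simp)), fun i j h => ?_⟩
  rw [← hf i j h]
  exact hσ i (mem_filter.2 ⟨mem_univ _, j, h⟩)

/-- Completing the matchings of a cover to permutations can only destroy colorings. -/
theorem DPCover.exists_numTwistedColorings_le {V W : Type*} [Fintype V] [Finite W]
    {G : SimpleGraph V} (C : G.DPCover W) {m : ℕ} (hC : C.IsFold m) :
    ∃ g : V → V → Equiv.Perm (Fin m), (∀ u v, g v u = (g u v)⁻¹) ∧
      G.numTwistedColorings g ≤ C.numColorings := by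
  classical
  let e : ∀ v, C.L v ≃ Fin m := fun v => Finset.equivFinOfCardEq (hC v)
  -- An orientation of the edges makes the permutations in the two directions mutually inverse.
  let r : V ≃ Fin (Fintype.card V) := Fintype.equivFin V
  have hex : ∀ u v, ∃ σ : Equiv.Perm (Fin m), G.Adj u v → ∀ i j,
      C.graph.Adj ((e u).symm i : W) ((e v).symm j) → σ i = j := fun u v => by
    by_cases h : G.Adj u v
    · obtain ⟨σ, hσ⟩ := C.exists_perm_extending_matching e h
      exact ⟨σ, fun _ => hσ⟩
    · exact ⟨1, fun h' => (h h').elim⟩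
  choose σ hσ using hex
  let g : V → V → Equiv.Perm (Fin m) := fun u v =>
    if r u < r v then σ u v else if r v < r u then (σ v u)⁻¹ else 1
  refine ⟨g, fun u v => ?_, ?_⟩
  · rcases lt_trichotomy (r u) (r v) with h | h | h
    · simp [g, h, h.not_gt]
    · simp [g, r.injective h]
    · simp [g, h, h.not_gt]
  · have hg : ∀ u v, G.Adj u v → ∀ i j,
        C.graph.Adj ((e u).symm i : W) ((e v).symm j) → g u v i = j := by
      intro u v huv i j h
      rcases lt_trichotomy (r u) (r v) with h' | h' | h'
      · simpa [g, h'] using hσ u v huv i j h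
      · exact (huv.ne (r.injective h')).elim
      · simp only [g, h', h'.not_gt, if_true, if_false]
        rw [Equiv.Perm.inv_eq_iff_eq]
        exact (hσ v u huv.symm j i h.symm).symm
    rw [C.numColorings_eq_card, numTwistedColorings, ← Fintype.card_subtype,
      ← Nat.card_eq_fintype_card]
    refine Nat.card_le_card_of_injective (fun c => ⟨fun v => (e v).symm (c.1 v),
      fun v => ((e v).symm (c.1 v)).2, fun u v h => ?_⟩) ?_
    · rcases C.eq_or_adj u v _ ((e u).symm _).2 _ ((e v).symm _).2 h with rfl | huv
      · exact h.ne rfl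
      · exact c.2 u v huv (hg u v huv _ _ h).symm
    · intro c d h
      ext v : 2
      have := congrFun (congrArg Subtype.val h) v
      exact (e v).symm.injective (Subtype.ext this)

theorem dpColorFunction_le_numTwistedColorings {V : Type u} [Fintype V] (G : SimpleGraph V)
    {m : ℕ} (g : V → V → Equiv.Perm (Fin m)) (hg : ∀ u v, g v u = (g u v)⁻¹) :
    G.dpColorFunction m ≤ G.numTwistedColorings g :=
  (G.isLeast_dpColorFunction m).2 (G.numTwistedColorings_mem_dpColoringCounts g hg)

/-- Together with `dpColorFunction_le_numTwistedColorings`: the DP color function is the least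
number of twisted colorings. -/
theorem exists_dpColorFunction_eq {V : Type u} [Fintype V] (G : SimpleGraph V) (m : ℕ) :
    ∃ g : V → V → Equiv.Perm (Fin m), (∀ u v, g v u = (g u v)⁻¹) ∧
      G.dpColorFunction m = G.numTwistedColorings g := by
  obtain ⟨W, _, C, hC, h⟩ := (G.isLeast_dpColorFunction m).1
  obtain ⟨g, hg, hle⟩ := C.exists_numTwistedColorings_le hC
  exact ⟨g, hg, le_antisymm (G.dpColorFunction_le_numTwistedColorings g hg) (h ▸ hle)⟩

/-! ### Twisted colorings of a path -/

open Classical in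
/-- The number of twisted colorings, with end colors `i` and `j`, of a path with `n` edges, where
`φ t` is the permutation from vertex `t` to vertex `t + 1`. -/
noncomputable def numTwistedPaths {m n : ℕ} (φ : Fin n → Equiv.Perm (Fin m)) (i j : Fin m) : ℕ :=
  #{x : Fin (n + 1) → Fin m | x 0 = i ∧ x (Fin.last n) = j ∧
    ∀ t : Fin n, x t.succ ≠ φ t (x t.castSucc)}

/-- The product of the permutations along a path, the first edge acting first. -/
def pathHolonomy {m : ℕ} : {n : ℕ} → (Fin n → Equiv.Perm (Fin m)) → Equiv.Perm (Fin m)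
  | 0, _ => 1
  | _ + 1, φ => pathHolonomy (Fin.tail φ) * φ 0

/-- The number of proper `m`-colorings of a path with `n` edges and prescribed distinct end colors;
for equal end colors the number is larger by `(-1) ^ n`. The closed form is `mul_pathConst`. The
values are integers because the recursion gives `-1` for `m = 1` and even `n > 0`, where the
correction for the only, equal, pair of end colors makes up for it. -/
def pathConst (m : ℕ) : ℕ → ℤ
  | 0 => 0
  | n + 1 => ((m : ℤ) - 1) * pathConst m n + (-1) ^ n

theorem mul_pathConst (m n : ℕ) : (m : ℤ) * pathConst m n = ((m : ℤ) - 1) ^ n - (-1) ^ n := by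
  induction n with
  | zero => simp [pathConst]
  | succ n ih =>
    rw [pathConst, mul_add, mul_left_comm, ih]
    ring

theorem numTwistedPaths_succ {m n : ℕ} (φ : Fin (n + 1) → Equiv.Perm (Fin m)) (i j : Fin m) :
    numTwistedPaths φ i j = ∑ k ∈ univ.erase (φ 0 i), numTwistedPaths (Fin.tail φ) k j := by
  classical
  simp only [numTwistedPaths]
  rw [← card_sigma]
  refine card_nbij' (fun x => ⟨x 1, Fin.tail x⟩) (fun p => Fin.cons i p.2) ?_ ?_ ?_ ?_
  · intro x hx
    simp only [coe_filter, mem_univ, true_and, Set.mem_ofPred_eq] at hx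
    obtain ⟨h0, hl, hx⟩ := hx
    simp only [coe_sigma, Set.mem_sigma_iff, coe_filter, mem_univ, true_and, Set.mem_ofPred_eq,
      coe_erase, coe_univ]
    refine ⟨?_, rfl, hl, fun t => hx t.succ⟩
    have := hx 0
    simpa [h0] using this
  · rintro ⟨k, y⟩ hy
    simp only [coe_sigma, Set.mem_sigma_iff, coe_filter, mem_univ, true_and, Set.mem_ofPred_eq,
      coe_erase, coe_univ] at hy
    obtain ⟨hk, h0, hl, hy⟩ := hy
    simp only [coe_filter, mem_univ, true_and, Set.mem_ofPred_eq]
    refine ⟨Fin.cons_zero _ _, ?_, fun t => ?_⟩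
    · rw [← Fin.succ_last, Fin.cons_succ, hl]
    · refine Fin.cases ?_ (fun t => ?_) t
      · rw [Fin.cons_succ, Fin.castSucc_zero, Fin.cons_zero, h0]
        simpa using hk
      · rw [Fin.cons_succ, ← Fin.succ_castSucc, Fin.cons_succ]
        exact hy t
  · intro x hx
    simp only [coe_filter, mem_univ, true_and, Set.mem_ofPred_eq] at hx
    simp [← hx.1]
  · rintro ⟨k, y⟩ hy
    simp only [coe_sigma, Set.mem_sigma_iff, coe_filter, mem_univ, true_and, Set.mem_ofPred_eq,
      coe_erase, coe_univ] at hy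
    obtain ⟨hk, rfl, hl, hy⟩ := hy
    simp only [Fin.tail_cons]
    rfl

/-- The number of twisted colorings of a path depends on the twist only through the holonomy. The
recursion sums over the colors of the second vertex other than the one forbidden by the first. -/
theorem numTwistedPaths_eq {m : ℕ} : ∀ {n : ℕ} (φ : Fin n → Equiv.Perm (Fin m)) (i j : Fin m),
    (numTwistedPaths φ i j : ℤ) =
      pathConst m n + (-1) ^ n * if pathHolonomy φ i = j then 1 else 0
  | 0, φ, i, j => by
    classical
    simp only [numTwistedPaths, pathConst, pathHolonomy, Equiv.Perm.one_apply]
    split_ifs with h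
    · subst h
      have : (univ.filter fun x : Fin (0 + 1) → Fin m => x 0 = i ∧ x (Fin.last 0) = i ∧
          ∀ t : Fin 0, x t.succ ≠ φ t (x t.castSucc)) = {fun _ => i} := by
        ext x
        simp only [mem_filter, mem_univ, true_and, mem_singleton]
        constructor
        · rintro ⟨h, -⟩
          funext t
          rw [← h, Subsingleton.elim (α := Fin 1) t 0]
        · rintro rfl
          exact ⟨rfl, rfl, fun t => t.elim0⟩
      rw [this]
      simp
    · rw [filter_eq_empty_iff.2]
      · simp [h]
      · rintro x - ⟨h0, hl, -⟩
        exact h (h0.symm.trans hl)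
  | n + 1, φ, i, j => by
    rw [numTwistedPaths_succ, Nat.cast_sum, ← sub_eq_iff_eq_add.2
      (sum_erase_add univ (fun k => (numTwistedPaths (Fin.tail φ) k j : ℤ))
        (mem_univ (φ 0 i))).symm]
    have h1 : ∀ k, (numTwistedPaths (Fin.tail φ) k j : ℤ) = pathConst m n + (-1) ^ n *
        if k = (pathHolonomy (Fin.tail φ))⁻¹ j then 1 else 0 := fun k => by
      rw [numTwistedPaths_eq (Fin.tail φ) k j]
      simp only [Equiv.Perm.eq_inv_iff_eq]
    have h2 : ((φ 0 i = (pathHolonomy (Fin.tail φ))⁻¹ j)) ↔ pathHolonomy φ i = j := by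
      rw [Equiv.Perm.eq_inv_iff_eq]
      rfl
    simp only [h1, sum_add_distrib, ← mul_sum, sum_ite_eq', mem_univ, if_true, h2, pathConst,
      sum_const, card_univ, Fintype.card_fin, nsmul_eq_mul]
    ring

theorem pathHolonomy_one {m : ℕ} : ∀ {n : ℕ},
    pathHolonomy (fun _ : Fin n => (1 : Equiv.Perm (Fin m))) = 1
  | 0 => rfl
  | n + 1 => by
    rw [pathHolonomy, mul_one]
    exact pathHolonomy_one

theorem pathHolonomy_eq_head {m n : ℕ} (φ : Fin (n + 1) → Equiv.Perm (Fin m))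
    (h : ∀ t : Fin n, φ t.succ = 1) : pathHolonomy φ = φ 0 := by
  rw [pathHolonomy, show Fin.tail φ = fun _ => 1 from funext h, pathHolonomy_one, one_mul]

/-- The sum, over the pairs `(i, j)` of colors with `j ≠ ψ i`, of the products of the numbers of
colorings of two paths with holonomies `Φ` and `Θ`. -/
theorem sum_paths_mul_paths {m p q : ℕ} (ψ Φ Θ : Equiv.Perm (Fin m)) :
    (∑ i : Fin m, ∑ j ∈ univ.erase (ψ i),
      (pathConst m p + (-1) ^ p * if Φ i = j then 1 else 0) *
        (pathConst m q + (-1) ^ q * if Θ i = j then 1 else 0) : ℤ) =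
      m * (m - 1) * pathConst m p * pathConst m q
        + (-1) ^ p * pathConst m q * #{i | Φ i ≠ ψ i}
        + (-1) ^ q * pathConst m p * #{i | Θ i ≠ ψ i}
        + (-1) ^ p * (-1) ^ q * #{i | Φ i = Θ i ∧ Φ i ≠ ψ i} := by
  have key : ∀ i : Fin m, (∑ j ∈ univ.erase (ψ i),
      (pathConst m p + (-1) ^ p * if Φ i = j then 1 else 0) *
        (pathConst m q + (-1) ^ q * if Θ i = j then 1 else 0) : ℤ) =
      (m - 1) * pathConst m p * pathConst m q
        + (-1) ^ p * pathConst m q * (if Φ i ≠ ψ i then 1 else 0)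
        + (-1) ^ q * pathConst m p * (if Θ i ≠ ψ i then 1 else 0)
        + (-1) ^ p * (-1) ^ q * (if Φ i = Θ i ∧ Φ i ≠ ψ i then 1 else 0) := by
    intro i
    have hm : 1 ≤ m := i.pos
    have h1 : ∀ j : Fin m, ((pathConst m p + (-1) ^ p * if Φ i = j then 1 else 0) *
        (pathConst m q + (-1) ^ q * if Θ i = j then 1 else 0) : ℤ) =
        pathConst m p * pathConst m q
        + (-1) ^ p * pathConst m q * (if Φ i = j then 1 else 0)
        + (-1) ^ q * pathConst m p * (if Θ i = j then 1 else 0)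
        + (-1) ^ p * (-1) ^ q * (if Φ i = j then (if Φ i = Θ i then 1 else 0) else 0) := by
      intro j
      split_ifs <;> first | (exfalso; simp_all; done) | ring
    simp only [h1, sum_add_distrib, ← mul_sum, sum_const, nsmul_eq_mul, sum_ite_eq, mem_erase,
      mem_univ, and_true, card_erase_of_mem, card_univ, Fintype.card_fin]
    push_cast [hm]
    simp only [and_comm (a := Φ i = Θ i), ite_and]
    ring
  rw [sum_congr rfl fun i _ => key i]
  simp only [sum_add_distrib, ← mul_sum, sum_boole, sum_const, card_univ, Fintype.card_fin,
    nsmul_eq_mul]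
  ring

/-! ### Two cycles glued along an edge -/

/-- The cycle is a path from `0` to `last` together with the edge between these. -/
theorem cycleGraph_adj_iff_sym2 {n : ℕ} (i j : Fin (n + 2)) :
    (cycleGraph (n + 2)).Adj i j ↔
      s(i, j) = s(0, Fin.last (n + 1)) ∨ ∃ t : Fin (n + 1), s(i, j) = s(t.castSucc, t.succ) := by
  have key : ∀ i j : Fin (n + 2), j - i = 1 ↔
      (i = Fin.last (n + 1) ∧ j = 0) ∨ ∃ t : Fin (n + 1), i = t.castSucc ∧ j = t.succ := by
    intro i j
    rw [sub_eq_iff_eq_add, add_comm (1 : Fin (n + 2)) i]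
    refine Fin.lastCases ?_ (fun t => ?_) i
    · rw [Fin.last_add_one]
      constructor
      · exact fun h => Or.inl ⟨rfl, h⟩
      · rintro (h | ⟨t, ht, -⟩)
        · exact h.2
        · exact absurd ht.symm (Fin.castSucc_lt_last t).ne
    · rw [Fin.coeSucc_eq_succ]
      constructor
      · exact fun h => Or.inr ⟨t, rfl, h⟩
      · rintro (⟨h, -⟩ | ⟨t', ht, h⟩)
        · exact absurd h (Fin.castSucc_lt_last t).ne
        · rw [h, Fin.castSucc_injective _ ht]
  rw [cycleGraph_adj, key, key]
  simp only [Sym2.eq_iff]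
  constructor
  · rintro ((⟨rfl, rfl⟩ | ⟨t, rfl, rfl⟩) | (⟨rfl, rfl⟩ | ⟨t, rfl, rfl⟩))
    · exact Or.inl (Or.inl ⟨rfl, rfl⟩)
    · exact Or.inr ⟨t, Or.inr ⟨rfl, rfl⟩⟩
    · exact Or.inl (Or.inr ⟨rfl, rfl⟩)
    · exact Or.inr ⟨t, Or.inl ⟨rfl, rfl⟩⟩
  · rintro ((⟨rfl, rfl⟩ | ⟨rfl, rfl⟩) | ⟨t, ⟨rfl, rfl⟩ | ⟨rfl, rfl⟩⟩)
    · exact Or.inl (Or.inl ⟨rfl, rfl⟩)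
    · exact Or.inr (Or.inl ⟨rfl, rfl⟩)
    · exact Or.inr (Or.inr ⟨t, rfl, rfl⟩)
    · exact Or.inl (Or.inr ⟨t, rfl, rfl⟩)

/-- A rotation or a reflection moves the edge from `0` to `last` to any given oriented edge. -/
theorem cycleGraph_exists_iso {n : ℕ} {a b : Fin (n + 2)} (h : (cycleGraph (n + 2)).Adj a b) :
    ∃ e : cycleGraph (n + 2) ≃g cycleGraph (n + 2), e 0 = a ∧ e (Fin.last (n + 1)) = b := by
  have hl : Fin.last (n + 1) = -1 := by
    rw [eq_neg_iff_add_eq_zero, Fin.last_add_one]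
  rw [cycleGraph_adj] at h
  rcases h with h | h
  · refine ⟨⟨Equiv.addLeft a, fun {x y} => ?_⟩, ?_, ?_⟩
    · simp [cycleGraph_adj]
    · simp
    · simp only [RelIso.coe_fn_mk, Equiv.coe_addLeft, hl, ← h]
      abel
  · refine ⟨⟨Equiv.subLeft a, fun {x y} => ?_⟩, ?_, ?_⟩
    · simp [cycleGraph_adj, or_comm]
    · simp
    · simp only [RelIso.coe_fn_mk, Equiv.subLeft_apply, hl, ← h]
      abel

/-- Removing an edge `ab` from a cycle leaves a path `α` from `a` to `b`. -/
theorem Subgraph.IsCycleOfLength.exists_path {V : Type*} {G : SimpleGraph V} {H : G.Subgraph}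
    {n : ℕ} (hn : 1 ≤ n) (hH : H.IsCycleOfLength (n + 1)) {a b : V} (hab : H.Adj a b) :
    ∃ α : Fin (n + 1) → V, Function.Injective α ∧ Set.range α = H.verts ∧ α 0 = a ∧
      α (Fin.last n) = b ∧ ∀ u v, H.Adj u v ↔
        s(u, v) = s(a, b) ∨ ∃ t : Fin n, s(u, v) = s(α t.castSucc, α t.succ) := by
  obtain ⟨n, rfl⟩ := Nat.exists_eq_add_of_le' hn
  obtain ⟨f⟩ := hH
  have hab' : H.coe.Adj ⟨a, H.edge_vert hab⟩ ⟨b, H.edge_vert hab.symm⟩ := hab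
  obtain ⟨e, he0, hel⟩ := cycleGraph_exists_iso (f.map_adj_iff.2 hab')
  let F : cycleGraph (n + 2) ≃g H.coe := e.trans f.symm
  have h0 : F 0 = ⟨a, H.edge_vert hab⟩ := by simp [F, he0]
  have hl : F (Fin.last (n + 1)) = ⟨b, H.edge_vert hab.symm⟩ := by simp [F, hel]
  refine ⟨fun i => F i, Subtype.val_injective.comp F.injective, ?_,
    congrArg Subtype.val h0, congrArg Subtype.val hl, ?_⟩
  · ext v
    constructor
    · rintro ⟨i, rfl⟩
      exact (F i).2
    · intro hv
      exact ⟨F.symm ⟨v, hv⟩, by simp⟩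
  · have hF : ∀ i j k l, s((F i : V), (F j : V)) = s((F k : V), (F l : V)) ↔
        s(i, j) = s(k, l) := by
      intro i j k l
      simp only [Sym2.eq_iff, Subtype.val_inj, F.injective.eq_iff]
    have key : ∀ i j, H.Adj (F i) (F j) ↔ s((F i : V), (F j : V)) = s(a, b) ∨
        ∃ t : Fin (n + 1), s((F i : V), (F j : V)) = s((F t.castSucc : V), (F t.succ : V)) := by
      intro i j
      have h1 : s(a, b) = s((F 0 : V), (F (Fin.last (n + 1)) : V)) := by rw [h0, hl]
      simp only [h1, hF]
      rw [← cycleGraph_adj_iff_sym2, ← F.map_adj_iff]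
      rfl
    intro u v
    constructor
    · intro h
      have := (key (F.symm ⟨u, H.edge_vert h⟩) (F.symm ⟨v, H.edge_vert h.symm⟩)).1
      simp only [RelIso.apply_symm_apply] at this
      exact this h
    · have hex : ∀ {i j}, s(u, v) = s((F i : V), (F j : V)) →
          (∃ i, (F i : V) = u) ∧ ∃ j, (F j : V) = v := by
        intro i j h
        rcases Sym2.eq_iff.1 h with ⟨rfl, rfl⟩ | ⟨rfl, rfl⟩
        · exact ⟨⟨i, rfl⟩, j, rfl⟩
        · exact ⟨⟨j, rfl⟩, i, rfl⟩
      intro h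
      have : (∃ i, (F i : V) = u) ∧ ∃ j, (F j : V) = v := by
        rcases h with h | ⟨t, h⟩
        · exact hex (i := 0) (j := Fin.last (n + 1)) (by rw [h, h0, hl])
        · exact hex h
      obtain ⟨⟨i, rfl⟩, j, rfl⟩ := this
      exact (key i j).2 h

/-- `G` consists of the edge from `α 0` to `α (last p)` and the two paths `α` and `β`, with `p` and
`q` edges, between the same two vertices, which have no other vertex in common. -/
structure IsThetaGraph {V : Type*} (G : SimpleGraph V) {p q : ℕ} (α : Fin (p + 1) → V)
    (β : Fin (q + 1) → V) : Prop where
  injective_left : Function.Injective α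
  injective_right : Function.Injective β
  mem_range : ∀ v, v ∈ Set.range α ∨ v ∈ Set.range β
  zero_eq : β 0 = α 0
  last_eq : β (Fin.last q) = α (Fin.last p)
  eq_zero_or_last : ∀ i j, α i = β j → α i = α 0 ∨ α i = α (Fin.last p)
  adj_iff : ∀ u v, G.Adj u v ↔ s(u, v) = s(α 0, α (Fin.last p)) ∨
    (∃ t : Fin p, s(u, v) = s(α t.castSucc, α t.succ)) ∨
    ∃ t : Fin q, s(u, v) = s(β t.castSucc, β t.succ)

theorem IsCliqueSum.exists_isThetaGraph {V : Type*} {G : SimpleGraph V} {H M : G.Subgraph}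
    (hsum : G.IsCliqueSum H M) (hedge : (H.edgeSet ∩ M.edgeSet).ncard = 1) {p q : ℕ}
    (hp : 1 ≤ p) (hq : 1 ≤ q) (hH : H.IsCycleOfLength (p + 1)) (hM : M.IsCycleOfLength (q + 1)) :
    ∃ (α : Fin (p + 1) → V) (β : Fin (q + 1) → V), G.IsThetaGraph α β := by
  obtain ⟨hsup, -, hHc, hMc⟩ := hsum
  obtain ⟨e, he⟩ := Set.ncard_eq_one.1 hedge
  induction e with | _ a b
  have hab : s(a, b) ∈ H.edgeSet ∩ M.edgeSet := he ▸ Set.mem_singleton _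
  have haH : H.Adj a b := hab.1
  have haM : M.Adj a b := hab.2
  obtain ⟨α, hα, hαr, hα0, hαl, hαadj⟩ := hH.exists_path hp haH
  obtain ⟨β, hβ, hβr, hβ0, hβl, hβadj⟩ := hM.exists_path hq haM
  refine ⟨α, β, hα, hβ, fun v => ?_, hβ0.trans hα0.symm, hβl.trans hαl.symm, ?_, ?_⟩
  · have : v ∈ (H ⊔ M).verts := hsup ▸ Set.mem_univ v
    rwa [hαr, hβr]
  · intro i j hij
    rw [hα0, hαl]
    by_contra! hne
    have hv : α i ∈ H.verts ∩ M.verts :=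
      ⟨hαr ▸ Set.mem_range_self i, hβr ▸ hij ▸ Set.mem_range_self j⟩
    have ha : a ∈ H.verts ∩ M.verts := ⟨H.edge_vert haH, M.edge_vert haM⟩
    -- A third common vertex would be joined to `a` by a second common edge.
    have : s(α i, a) ∈ H.edgeSet ∩ M.edgeSet := ⟨hHc hv ha hne.1, hMc hv ha hne.1⟩
    rw [he, Set.mem_singleton_iff, Sym2.eq_iff] at this
    rcases this with h | h
    · exact hne.1 h.1
    · exact hne.2 h.1
  · intro u v
    have h1 : G.Adj u v ↔ H.Adj u v ∨ M.Adj u v := by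
      rw [← Subgraph.sup_adj, hsup, Subgraph.top_adj]
    rw [h1, hαadj, hβadj, hα0, hαl]
    tauto

/-- A coloring is twisted if and only if it satisfies one condition for each edge of the two paths
and one for the edge that joins their ends. -/
theorem IsThetaGraph.twisted_iff {V : Type*} {G : SimpleGraph V} {p q : ℕ}
    {α : Fin (p + 1) → V} {β : Fin (q + 1) → V} (h : G.IsThetaGraph α β) {m : ℕ}
    {g : V → V → Equiv.Perm (Fin m)} (hg : ∀ u v, g v u = (g u v)⁻¹) (c : V → Fin m) :
    (∀ u v, G.Adj u v → c v ≠ g u v (c u)) ↔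
      c (α (Fin.last p)) ≠ g (α 0) (α (Fin.last p)) (c (α 0)) ∧
      (∀ t : Fin p, c (α t.succ) ≠ g (α t.castSucc) (α t.succ) (c (α t.castSucc))) ∧
      ∀ t : Fin q, c (β t.succ) ≠ g (β t.castSucc) (β t.succ) (c (β t.castSucc)) := by
  constructor
  · intro hc
    exact ⟨hc _ _ ((h.adj_iff _ _).2 (Or.inl rfl)),
      fun t => hc _ _ ((h.adj_iff _ _).2 (Or.inr (Or.inl ⟨t, rfl⟩))),
      fun t => hc _ _ ((h.adj_iff _ _).2 (Or.inr (Or.inr ⟨t, rfl⟩)))⟩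
  · rintro ⟨h0, h1, h2⟩ u v huv
    have key : ∀ x y, s(u, v) = s(x, y) → c y ≠ g x y (c x) → c v ≠ g u v (c u) := by
      intro x y hxy hc
      rcases Sym2.eq_iff.1 hxy with ⟨rfl, rfl⟩ | ⟨rfl, rfl⟩
      · exact hc
      · rw [hg v u, ne_eq, Equiv.Perm.eq_inv_iff_eq, eq_comm]
        exact hc
    rcases (h.adj_iff u v).1 huv with e | ⟨t, e⟩ | ⟨t, e⟩
    · exact key _ _ e h0
    · exact key _ _ e (h1 t)
    · exact key _ _ e (h2 t)

theorem IsThetaGraph.exists_glue {V : Type*} {G : SimpleGraph V} {p q : ℕ}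
    {α : Fin (p + 1) → V} {β : Fin (q + 1) → V} (h : G.IsThetaGraph α β) {A : Type*}
    (x : Fin (p + 1) → A) (y : Fin (q + 1) → A) (h0 : x 0 = y 0)
    (hl : x (Fin.last p) = y (Fin.last q)) :
    ∃ c : V → A, c ∘ α = x ∧ c ∘ β = y := by
  classical
  have hx : ∀ i j, α i = β j → x i = y j := by
    intro i j hij
    rcases h.eq_zero_or_last i j hij with hi | hi
    · rw [h.injective_left hi, h0, h.injective_right (h.zero_eq.trans (hi.symm.trans hij))]
    · rw [h.injective_left hi, hl, h.injective_right (h.last_eq.trans (hi.symm.trans hij))]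
  have hy : ∀ v, v ∉ Set.range α → v ∈ Set.range β := fun v hv => (h.mem_range v).resolve_left hv
  refine ⟨fun v => if hv : v ∈ Set.range α then x hv.choose else y (hy v hv).choose, ?_, ?_⟩
  · funext i
    have hi : α i ∈ Set.range α := ⟨i, rfl⟩
    simp only [Function.comp_apply, dif_pos hi]
    rw [h.injective_left hi.choose_spec]
  · funext j
    simp only [Function.comp_apply]
    split_ifs with hj
    · exact hx _ _ hj.choose_spec
    · rw [h.injective_right (hy _ hj).choose_spec]

theorem IsThetaGraph.numTwistedColorings_eq_sum {V : Type*} [Fintype V] {G : SimpleGraph V}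
    {p q : ℕ} {α : Fin (p + 1) → V} {β : Fin (q + 1) → V} (h : G.IsThetaGraph α β) {m : ℕ}
    {g : V → V → Equiv.Perm (Fin m)} (hg : ∀ u v, g v u = (g u v)⁻¹) :
    G.numTwistedColorings g = ∑ i, ∑ j ∈ univ.erase (g (α 0) (α (Fin.last p)) i),
      numTwistedPaths (fun t => g (α t.castSucc) (α t.succ)) i j *
        numTwistedPaths (fun t => g (β t.castSucc) (β t.succ)) i j := by
  classical
  simp only [numTwistedColorings, h.twisted_iff hg, numTwistedPaths, ← card_product,
    ← card_sigma]
  refine card_nbij (fun c => ⟨c (α 0), c (α (Fin.last p)), c ∘ α, c ∘ β⟩) ?_ ?_ ?_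
  · intro c hc
    simp only [coe_filter, mem_univ, true_and, Set.mem_ofPred_eq] at hc
    simpa [h.zero_eq, h.last_eq] using hc
  · intro c hc d hd hcd
    have hα : c ∘ α = d ∘ α := congrArg (fun z => z.2.2.1) hcd
    have hβ : c ∘ β = d ∘ β := congrArg (fun z => z.2.2.2) hcd
    funext v
    rcases h.mem_range v with ⟨i, rfl⟩ | ⟨i, rfl⟩
    · exact congrFun hα i
    · exact congrFun hβ i
  · rintro ⟨i, j, x, y⟩ hxy
    simp only [coe_sigma, Set.mem_sigma_iff, coe_univ, Set.mem_univ, true_and, mem_coe, mem_erase,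
      mem_product, mem_filter, mem_univ, and_true] at hxy
    obtain ⟨hij, ⟨rfl, rfl, hx⟩, hy0, hyl, hy⟩ := hxy
    obtain ⟨c, rfl, rfl⟩ := h.exists_glue x y hy0.symm hyl.symm
    refine ⟨c, ?_, rfl⟩
    simp only [coe_filter, mem_univ, true_and, Set.mem_ofPred_eq]
    exact ⟨hij, hx, hy⟩

/-! ### The DP color function of two cycles glued along an edge -/

theorem IsThetaGraph.numTwistedColorings_eq {V : Type*} [Fintype V] {G : SimpleGraph V}
    {p q : ℕ} {α : Fin (p + 1) → V} {β : Fin (q + 1) → V} (h : G.IsThetaGraph α β) {m : ℕ}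
    {g : V → V → Equiv.Perm (Fin m)} (hg : ∀ u v, g v u = (g u v)⁻¹)
    {ψ Φ Θ : Equiv.Perm (Fin m)} (hψ : g (α 0) (α (Fin.last p)) = ψ)
    (hΦ : pathHolonomy (fun t : Fin p => g (α t.castSucc) (α t.succ)) = Φ)
    (hΘ : pathHolonomy (fun t : Fin q => g (β t.castSucc) (β t.succ)) = Θ) :
    (G.numTwistedColorings g : ℤ) =
      m * (m - 1) * pathConst m p * pathConst m q
        + (-1) ^ p * pathConst m q * #{i | Φ i ≠ ψ i}
        + (-1) ^ q * pathConst m p * #{i | Θ i ≠ ψ i}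
        + (-1) ^ p * (-1) ^ q * #{i | Φ i = Θ i ∧ Φ i ≠ ψ i} := by
  rw [h.numTwistedColorings_eq_sum hg, ← sum_paths_mul_paths, hψ, ← hΦ, ← hΘ]
  push_cast
  simp only [numTwistedPaths_eq]

/-- Any two permutations are the holonomies of some twist that is trivial on the common edge: the
first edges of the two paths carry them, and all other edges of the graph are trivial. -/
theorem IsThetaGraph.exists_twist {V : Type*} {G : SimpleGraph V}
    {p q : ℕ} {α : Fin (p + 1) → V} {β : Fin (q + 1) → V} (h : G.IsThetaGraph α β)
    (hp : 2 ≤ p) (hq : 2 ≤ q) {m : ℕ} (Φ Θ : Equiv.Perm (Fin m)) :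
    ∃ g : V → V → Equiv.Perm (Fin m), (∀ u v, g v u = (g u v)⁻¹) ∧
      g (α 0) (α (Fin.last p)) = 1 ∧
      pathHolonomy (fun t : Fin p => g (α t.castSucc) (α t.succ)) = Φ ∧
      pathHolonomy (fun t : Fin q => g (β t.castSucc) (β t.succ)) = Θ := by
  classical
  obtain ⟨p, rfl⟩ := Nat.exists_eq_add_of_le' hp
  obtain ⟨q, rfl⟩ := Nat.exists_eq_add_of_le' hq
  -- Only edges at `α 0` are twisted; the one to `v` by `f v`.
  let f : V → Equiv.Perm (Fin m) := fun v =>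
    if v = α 0 ∨ v = α (Fin.last (p + 2)) then 1 else if v ∈ Set.range α then Φ else Θ
  let g : V → V → Equiv.Perm (Fin m) := fun u v =>
    if u = α 0 then f v else if v = α 0 then (f u)⁻¹ else 1
  have hα0 : ∀ t : Fin (p + 2), α t.succ ≠ α 0 := fun t ht =>
    (Fin.succ_ne_zero t) (h.injective_left ht)
  have hβ0 : ∀ t : Fin (q + 2), β t.succ ≠ α 0 := fun t ht =>
    (Fin.succ_ne_zero t) (h.injective_right (ht.trans h.zero_eq.symm))
  have hαl : α (Fin.succ 0) ≠ α (Fin.last (p + 2)) := fun ht => by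
    simpa [Fin.ext_iff] using h.injective_left ht
  have hβl : β (Fin.succ 0) ≠ α (Fin.last (p + 2)) := fun ht => by
    simpa [Fin.ext_iff] using h.injective_right (ht.trans h.last_eq.symm)
  have hβα : β (Fin.succ 0) ∉ Set.range α := by
    rintro ⟨i, hi⟩
    rcases h.eq_zero_or_last i _ hi with h' | h'
    · exact hβ0 0 (hi.symm.trans h')
    · exact hβl (hi.symm.trans h')
  refine ⟨g, fun u v => ?_, ?_, ?_, ?_⟩
  · by_cases hu : u = α 0 <;> by_cases hv : v = α 0 <;> simp [g, f, hu, hv]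
  · simp [g, f]
  · rw [pathHolonomy_eq_head]
    · simp only [g, f, Fin.castSucc_zero, if_true, hα0, hαl, or_self, if_false,
        Set.mem_range_self]
    · intro t
      simp only [g, ← Fin.succ_castSucc, hα0, if_false]
  · rw [pathHolonomy_eq_head]
    · simp only [g, f, Fin.castSucc_zero, h.zero_eq, if_true, hβ0, hβl, or_self, if_false, hβα]
    · intro t
      simp only [g, ← Fin.succ_castSucc, hβ0, if_false]

theorem pathConst_even_nonneg {m : ℕ} (hm : 2 ≤ m) (k : ℕ) : 0 ≤ pathConst m (2 * k) := by
  have h := mul_pathConst m (2 * k)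
  have hm' : (2 : ℤ) ≤ m := by exact_mod_cast hm
  have h1 : (1 : ℤ) ≤ (m - 1) ^ (2 * k) := one_le_pow₀ (by linarith)
  rw [pow_mul (-1 : ℤ), neg_one_sq, one_pow] at h
  refine nonneg_of_mul_nonneg_right (a := (m : ℤ)) (h ▸ by linarith) (by linarith)

theorem one_le_pathConst_odd {m : ℕ} (hm : 1 ≤ m) (k : ℕ) : 1 ≤ pathConst m (2 * k + 1) := by
  have h := mul_pathConst m (2 * k + 1)
  have hm' : (1 : ℤ) ≤ m := by exact_mod_cast hm
  have h1 : (0 : ℤ) ≤ (m - 1) ^ (2 * k + 1) := pow_nonneg (by linarith) _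
  rw [pow_succ (-1 : ℤ), pow_mul (-1 : ℤ), neg_one_sq, one_pow] at h
  refine pos_of_mul_pos_right (a := (m : ℤ)) (h ▸ by linarith) (by linarith)

theorem IsThetaGraph.dpColorFunction_even_even {V : Type u} [Fintype V] {G : SimpleGraph V}
    {k l : ℕ} {α : Fin (2 * k + 1) → V} {β : Fin (2 * l + 1) → V} (h : G.IsThetaGraph α β)
    (m : ℕ) (hm : 1 ≤ m) : G.dpColorFunction m = G.numProperColorings m := by
  have hle := G.dpColorFunction_le_numTwistedColorings (m := m) (fun _ _ => 1) (by simp)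
  rw [← numTwistedColorings_one]
  refine le_antisymm hle ?_
  obtain ⟨g, hg, hdp⟩ := G.exists_dpColorFunction_eq m
  rw [hdp]
  rcases hm.eq_or_lt with rfl | hm
  -- For `m = 1` the numbers `pathConst` may be negative, but there is only one twist.
  · rw [show g = fun _ _ => 1 from funext fun _ => funext fun _ => Subsingleton.elim _ _]
  · zify
    rw [h.numTwistedColorings_eq hg rfl rfl rfl,
      h.numTwistedColorings_eq (by simp) rfl pathHolonomy_one pathHolonomy_one]
    generalize pathHolonomy _ = Φ
    generalize pathHolonomy _ = Θ
    generalize g _ _ = ψ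
    have e1 := mul_nonneg (pathConst_even_nonneg hm l) (Nat.cast_nonneg (α := ℤ) #{i | Φ i ≠ ψ i})
    have e2 := mul_nonneg (pathConst_even_nonneg hm k) (Nat.cast_nonneg (α := ℤ) #{i | Θ i ≠ ψ i})
    have e3 := Nat.cast_nonneg (α := ℤ) #{i | Φ i = Θ i ∧ Φ i ≠ ψ i}
    simp only [Even.neg_one_pow (even_two_mul _), one_mul, ne_eq, not_true_eq_false, and_false,
      filter_false, card_empty, Nat.cast_zero, mul_zero, add_zero] at e1 e2 e3 ⊢
    linarith

/-- The minimum is attained for holonomies `Φ` and `Θ` that are the translations by `1` and by `2`: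
both move every color, and they agree nowhere because `m ≥ 3`. -/
theorem IsThetaGraph.dpColorFunction_odd_odd {V : Type u} [Fintype V] {G : SimpleGraph V}
    {k l : ℕ} (hk : 1 ≤ k) (hl : 1 ≤ l)
    {α : Fin (2 * k + 1 + 1) → V} {β : Fin (2 * l + 1 + 1) → V} (h : G.IsThetaGraph α β)
    (m : ℕ) (hm : 3 ≤ m) :
    (G.dpColorFunction m : ℤ) =
      m * (m - 1) * pathConst m (2 * k + 1) * pathConst m (2 * l + 1)
        - m * pathConst m (2 * l + 1) - m * pathConst m (2 * k + 1) := by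
  have h1 := one_le_pathConst_odd (m := m) (by omega) k
  have h2 := one_le_pathConst_odd (m := m) (by omega) l
  have hc : ∀ s : Finset (Fin m), (#s : ℤ) ≤ m := fun s => by
    exact_mod_cast (card_le_univ s).trans (by simp)
  apply le_antisymm
  · obtain ⟨m, rfl⟩ := Nat.exists_eq_add_of_le' hm
    obtain ⟨g, hg, hψ, hΦ, hΘ⟩ := h.exists_twist (by omega) (by omega)
      (Equiv.addRight (1 : Fin (m + 3))) (Equiv.addRight 2)
    have hle := G.dpColorFunction_le_numTwistedColorings g hg
    zify at hle
    refine hle.trans (le_of_eq ?_)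
    have h12 : (1 : Fin (m + 3)) ≠ 2 := by
      simp [Fin.ext_iff, Nat.mod_eq_of_lt (show 2 < m + 3 by omega)]
    have h20 : (2 : Fin (m + 3)) ≠ 0 := by
      simp [Fin.ext_iff, Nat.mod_eq_of_lt (show 2 < m + 3 by omega)]
    rw [h.numTwistedColorings_eq hg hψ hΦ hΘ]
    simp only [Equiv.coe_addRight, Equiv.Perm.one_apply, ne_eq, add_eq_left, one_ne_zero, h20,
      add_right_inj, h12, not_false_eq_true, and_true, filter_true, filter_false, card_empty,
      card_univ, Fintype.card_fin, pow_succ, pow_mul]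
    push_cast
    ring
  · obtain ⟨g, hg, hdp⟩ := G.exists_dpColorFunction_eq m
    rw [hdp, h.numTwistedColorings_eq hg rfl rfl rfl]
    generalize pathHolonomy _ = Φ
    generalize pathHolonomy _ = Θ
    generalize g _ _ = ψ
    have e1 := mul_le_mul_of_nonneg_left (hc {i | Φ i ≠ ψ i}) (zero_le_one.trans h2)
    have e2 := mul_le_mul_of_nonneg_left (hc {i | Θ i ≠ ψ i}) (zero_le_one.trans h1)
    have e3 : (0 : ℤ) ≤ #{i | Φ i = Θ i ∧ Φ i ≠ ψ i} := Nat.cast_nonneg _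
    simp only [Odd.neg_one_pow (odd_two_mul_add_one _), one_mul, neg_mul, mul_neg, neg_neg]
    linarith

/-- The minimum is attained for a trivial holonomy along the even path and a derangement along the
odd one. -/
theorem IsThetaGraph.dpColorFunction_even_odd {V : Type u} [Fintype V] {G : SimpleGraph V}
    {k l : ℕ} (hk : 1 ≤ k) (hl : 1 ≤ l)
    {α : Fin (2 * k + 1) → V} {β : Fin (2 * l + 1 + 1) → V} (h : G.IsThetaGraph α β)
    (m : ℕ) (hm : 2 ≤ m) :
    (G.dpColorFunction m : ℤ) =
      m * (m - 1) * pathConst m (2 * k) * pathConst m (2 * l + 1) - m * pathConst m (2 * k) := by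
  have h1 := pathConst_even_nonneg hm k
  have h2 := one_le_pathConst_odd (m := m) (by omega) l
  have hc : ∀ s : Finset (Fin m), (#s : ℤ) ≤ m := fun s => by
    exact_mod_cast (card_le_univ s).trans (by simp)
  apply le_antisymm
  · obtain ⟨m, rfl⟩ := Nat.exists_eq_add_of_le' hm
    obtain ⟨g, hg, hψ, hΦ, hΘ⟩ := h.exists_twist (by omega) (by omega)
      1 (Equiv.addRight (1 : Fin (m + 2)))
    have hle := G.dpColorFunction_le_numTwistedColorings g hg
    zify at hle
    refine hle.trans (le_of_eq ?_)
    rw [h.numTwistedColorings_eq hg hψ hΦ hΘ]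
    simp only [Equiv.coe_addRight, Equiv.Perm.one_apply, ne_eq, add_eq_left, one_ne_zero,
      not_true_eq_false, and_false,
      not_false_eq_true, filter_true, filter_false, card_empty,
      card_univ, Fintype.card_fin, pow_succ, pow_mul]
    push_cast
    ring
  · obtain ⟨g, hg, hdp⟩ := G.exists_dpColorFunction_eq m
    rw [hdp, h.numTwistedColorings_eq hg rfl rfl rfl]
    generalize pathHolonomy _ = Φ
    generalize pathHolonomy _ = Θ
    generalize g _ _ = ψ
    have e2 := mul_le_mul_of_nonneg_left (hc {i | Θ i ≠ ψ i}) h1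
    -- Agreement of `Φ` and `Θ` off `ψ` saves no more than the difference of `Φ` and `ψ` costs.
    have e3 : (#{i | Φ i = Θ i ∧ Φ i ≠ ψ i} : ℤ) ≤ #{i | Φ i ≠ ψ i} :=
      Nat.cast_le.2 (card_le_card fun i hi => by
        simp only [mem_filter] at hi ⊢
        exact ⟨hi.1, hi.2.2⟩)
    have e1 := le_mul_of_one_le_left (Nat.cast_nonneg (α := ℤ) #{i | Φ i ≠ ψ i}) h2
    simp only [Even.neg_one_pow (even_two_mul _), Odd.neg_one_pow (odd_two_mul_add_one _), one_mul,
      neg_mul]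
    linarith

theorem pathConst_eq_div {m : ℕ} (hm : m ≠ 0) (n : ℕ) :
    (pathConst m n : ℚ) = (((m : ℚ) - 1) ^ n - (-1) ^ n) / m :=
  eq_div_of_mul_eq (Nat.cast_ne_zero.2 hm)
    ((mul_comm _ _).trans (by exact_mod_cast mul_pathConst m n))

end SimpleGraph

theorem mainTheorem6 {V : Type u} [Fintype V] (G : SimpleGraph V) (H M : G.Subgraph)
    (hsum : G.IsCliqueSum H M) (hedge : (H.edgeSet ∩ M.edgeSet).ncard = 1) (k l : ℕ) :
    (1 ≤ k → k ≤ l → H.IsCycleOfLength (2 * k + 1) → M.IsCycleOfLength (2 * l + 1) →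
      ∀ m : ℕ, 1 ≤ m → G.dpColorFunction m = G.numProperColorings m) ∧
    (1 ≤ k → k ≤ l → H.IsCycleOfLength (2 * k + 2) → M.IsCycleOfLength (2 * l + 2) →
      ∀ m : ℕ, 3 ≤ m →
        (G.dpColorFunction m : ℚ) =
          1 / (m : ℚ) * (((m : ℚ) - 1) ^ (2 * k + 2 * l + 3) - ((m : ℚ) - 1) ^ (2 * l + 1)
            - ((m : ℚ) - 1) ^ (2 * k + 1) - (m : ℚ) - 1)) ∧
    (1 ≤ k → 1 ≤ l → H.IsCycleOfLength (2 * k + 1) → M.IsCycleOfLength (2 * l + 2) →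
      ∀ m : ℕ, 2 ≤ m →
        (G.dpColorFunction m : ℚ) =
          1 / (m : ℚ) * (((m : ℚ) - 1) ^ (2 * k + 2 * l + 2) - ((m : ℚ) - 1) ^ (2 * k)
            - ((m : ℚ) - 1) ^ (2 * l + 2) + 1)) := by
  refine ⟨fun hk hkl hH hM m hm => ?_, fun hk hkl hH hM m hm => ?_, fun hk hl hH hM m hm => ?_⟩
  · obtain ⟨α, β, h⟩ := hsum.exists_isThetaGraph hedge (by omega) (by omega) hH hM
    exact h.dpColorFunction_even_even m hm
  · obtain ⟨α, β, h⟩ := hsum.exists_isThetaGraph hedge (p := 2 * k + 1) (q := 2 * l + 1)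
      (by omega) (by omega) hH hM
    have hdp := congrArg (Int.cast : ℤ → ℚ)
      (h.dpColorFunction_odd_odd hk (hk.trans hkl) m hm)
    push_cast at hdp
    have hm0 : (m : ℚ) ≠ 0 := by positivity
    have hm' : m ≠ 0 := by omega
    rw [hdp, SimpleGraph.pathConst_eq_div hm', SimpleGraph.pathConst_eq_div hm']
    simp only [pow_succ, pow_add, pow_mul (-1 : ℚ)]
    field_simp
    ring
  · obtain ⟨α, β, h⟩ := hsum.exists_isThetaGraph hedge (p := 2 * k) (q := 2 * l + 1)
      (by omega) (by omega) hH hM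
    have hdp := congrArg (Int.cast : ℤ → ℚ) (h.dpColorFunction_even_odd hk hl m hm)
    push_cast at hdp
    have hm0 : (m : ℚ) ≠ 0 := by positivity
    have hm' : m ≠ 0 := by omega
    rw [hdp, SimpleGraph.pathConst_eq_div hm', SimpleGraph.pathConst_eq_div hm']
    simp only [pow_succ, pow_add, pow_mul (-1 : ℚ)]
    field_simp
    ring
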